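/- Let $m\ge 0$, let $\Omega\subset\mathbb{R}^m$ be open and convex, and for $K\subset\mathbb{R}^m$ put $T_K=\{x+iy : x\in\mathbb{R}^m,\ y\in K\}\subset\mathbb{C}^m$. Let $X$ be a (finite-dimensional) complex manifold with a metric $d$ that induces its topology. A continuous map $F:T_K\to X$ is called semi periodic (almost periodic) on $T_K$ if the family of its real shifts $z\mapsto F(z+t)$, $t\in\mathbb{R}^m$, is relatively compact in the topology of uniform convergence on $T_K$. A holomorphic map $F:T_\Omega\to X$ is called semi periodic on $T_\Omega$ if for every compact $K\subset\Omega$ its restriction to $T_K$ is semi periodic. Theorem. Let $F:T_\Omega\to X$ be a holomorphic map such that for every compact $K\subset\Omega$ the map $F$ is uniformly continuous on $T_K$ (with respect to $d$) and $F(T_K)$ is a relatively compact subset of $X$. If for some $y'\in\Omega$ the restriction of $F$ to $\mathbb{R}^m+iy'=T_{\{y'\}}$ is semi periodic, then $F$ is semi periodic on $T_\Omega$. -/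

import Mathlib

open scoped Manifold

namespace SemiPeriodic

/-- The point `x + i y` of `ℂ^m`, for `x, y ∈ ℝ^m`. Both spaces are finite powers; their product
norms are equivalent to the Euclidean ones, and only the topology, the uniform structure and the
linear structure are used below. -/
def point {m : ℕ} (x y : Fin m → ℝ) : Fin m → ℂ :=
  fun j => (x j : ℂ) + Complex.I * (y j : ℂ)

/-- The tube `T_K = {x + i y : x ∈ ℝ^m, y ∈ K}` with base `K ⊆ ℝ^m`. -/
def tube {m : ℕ} (K : Set (Fin m → ℝ)) : Set (Fin m → ℂ) :=
  {z | ∃ x y : Fin m → ℝ, y ∈ K ∧ z = point x y}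

/-- The shift `z ↦ z + t` of `ℂ^m` by a real vector `t ∈ ℝ^m`; it maps every tube onto itself. -/
def shift {m : ℕ} (t : Fin m → ℝ) (z : Fin m → ℂ) : Fin m → ℂ :=
  fun j => z j + (t j : ℂ)

/-- The family of the shifts `F(z + t)`, `t ∈ ℝ^m`, as maps `T_K → X`, inside the space
`T_K →ᵤ X` of all maps `T_K → X` with the topology of uniform convergence on `T_K`. -/
def shiftFamily {m : ℕ} {X : Type*} [MetricSpace X]
    (F : (Fin m → ℂ) → X) (K : Set (Fin m → ℝ)) : Set (UniformFun (tube K) X) :=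
  Set.range fun t : Fin m → ℝ => UniformFun.ofFun fun z : tube K => F (shift t (z : Fin m → ℂ))

/-- `F` is semi periodic on the tube `T_K`: it is continuous there and the family of its real
shifts is relatively compact for uniform convergence on `T_K`. (For continuous `F`
all limits are again continuous, so that it makes no difference whether the closure is taken among
all maps or among the continuous ones.) -/
def IsSemiPeriodicOnTube {m : ℕ} {X : Type*} [MetricSpace X]
    (F : (Fin m → ℂ) → X) (K : Set (Fin m → ℝ)) : Prop :=
  ContinuousOn F (tube K) ∧ IsCompact (closure (shiftFamily F K))

/-- `F` is semi periodic on the tube `T_Ω` with open base: it is so on every `T_K` with compact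
base `K ⊆ Ω`. -/
def IsSemiPeriodicOnTubeDomain {m : ℕ} {X : Type*} [MetricSpace X]
    (F : (Fin m → ℂ) → X) (Ω : Set (Fin m → ℝ)) : Prop :=
  ∀ K : Set (Fin m → ℝ), IsCompact K → K ⊆ Ω → IsSemiPeriodicOnTube F K

end SemiPeriodic

namespace SemiPeriodic

open Metric Set Filter Topology

/-! ### Two-constants estimate on a half-disc. -/

section TwoConstants

variable {E : Type*} [NormedAddCommGroup E] [NormedSpace ℂ E]

/-! Since `F` has relatively compact image on `T_K`, semi periodicity there amounts to total
boundedness of the shifts. So it suffices that uniform closeness of two shifts on `ℝ^m + i y'`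
forces uniform closeness on `T_K` (`controlsShifts_of_isCompact`). For nearby heights `y`, `w`,
restrict both shifts to a complex line joining them. Uniform continuity keeps the two discs in one
small ball, and compactness gives such balls a uniform radius inside charts. There the difference is
bounded, and small on the real diameter, hence small at `i / 2` by the two-constants estimate.
Connectedness of `Ω` and compactness of `K` make this global. -/

theorem re_neg_mul_sub_I_sq (N : ℝ) (ζ : ℂ) :
    (-(N : ℂ) * (ζ - Complex.I) ^ 2).re = N * ((1 - ζ.im) ^ 2 - ζ.re ^ 2) := by
  simp [pow_two, Complex.mul_re]
  ring

/-- A two-constants estimate: a holomorphic function on a disc which is bounded by `M` and is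
bounded by `η` on the real diameter is small at `i / 2`. -/
theorem norm_mul_exp_le_max {h : ℂ → E} {M η N : ℝ} (hN : 0 ≤ N)
    (hd : DifferentiableOn ℂ h (ball 0 2)) (hM : ∀ ζ ∈ ball (0 : ℂ) 2, ‖h ζ‖ ≤ M)
    (hη : ∀ x : ℝ, |x| ≤ 1 → ‖h x‖ ≤ η) :
    ‖h (Complex.I / 2)‖ * Real.exp (N / 4) ≤ max M (η * Real.exp N) := by
  have hM0 : 0 ≤ M := (norm_nonneg _).trans (hM 0 (by simp))
  have hη0 : 0 ≤ η := (norm_nonneg _).trans (hη 0 (by simp))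
  set U : Set ℂ := ball 0 1 ∩ {z | 0 < z.im} with hU
  have hUo : IsOpen U := isOpen_ball.inter (isOpen_lt continuous_const Complex.continuous_im)
  have hcl : closure U ⊆ closedBall 0 1 ∩ {z | 0 ≤ z.im} :=
    closure_minimal
      (inter_subset_inter ball_subset_closedBall fun z (hz : 0 < z.im) => hz.le)
      (isClosed_closedBall.inter (isClosed_le continuous_const Complex.continuous_im))
  have hsub : closure U ⊆ ball 0 2 := fun z hz =>
    closedBall_subset_ball (by norm_num) (hcl hz).1
  -- The weight has modulus at most `1` on the upper unit semicircle, at most `exp N` on the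
  -- diameter, and exactly `exp (N / 4)` at `i / 2`.
  set G : ℂ → E := fun ζ => Complex.exp (-(N : ℂ) * (ζ - Complex.I) ^ 2) • h ζ with hG
  have hGn : ∀ ζ, ‖G ζ‖ = Real.exp (N * ((1 - ζ.im) ^ 2 - ζ.re ^ 2)) * ‖h ζ‖ := fun ζ => by
    rw [hG, norm_smul, Complex.norm_exp, re_neg_mul_sub_I_sq]
  have hGd : DifferentiableOn ℂ G (closure U) := by
    have h1 : DifferentiableOn ℂ (fun ζ : ℂ => Complex.exp (-(N : ℂ) * (ζ - Complex.I) ^ 2))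
        (closure U) := by fun_prop
    exact h1.smul (hd.mono hsub)
  have key := Complex.norm_le_of_forall_mem_frontier_norm_le (C := max M (η * Real.exp N))
    (z := Complex.I / 2) (isBounded_ball.subset inter_subset_left) hGd.diffContOnCl
    (fun z hz => ?_) (subset_closure ?_)
  · rw [hGn] at key
    refine le_trans (le_of_eq ?_) key
    rw [mul_comm]
    congr 2
    simp
    ring
  · obtain ⟨hz1, hz2⟩ := hcl hz.1
    simp only [mem_closedBall, dist_zero_right, mem_ofPred_eq] at hz1 hz2
    have hsq : z.re ^ 2 + z.im ^ 2 = ‖z‖ ^ 2 := by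
      rw [Complex.sq_norm, Complex.normSq_apply]; ring
    rw [hGn]
    rcases hz2.eq_or_lt with him | him
    · have hzr : z = (z.re : ℂ) := Complex.ext rfl (by simp [← him])
      have h1 : ‖h z‖ ≤ η := by
        rw [hzr]
        exact hη _ ((Complex.abs_re_le_norm z).trans hz1)
      refine le_max_of_le_right ?_
      rw [mul_comm]
      refine mul_le_mul h1 (Real.exp_le_exp.2 ?_) (Real.exp_pos _).le hη0
      rw [← him]
      nlinarith [sq_nonneg z.re]
    · have hn : ‖z‖ = 1 := by
        refine le_antisymm hz1 (not_lt.1 fun hlt => hz.2 ?_)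
        rw [hUo.interior_eq]
        exact ⟨by simpa using hlt, him⟩
      have him1 : z.im ≤ 1 := (Complex.abs_im_le_norm z |> (le_abs_self _).trans).trans hz1
      refine le_max_of_le_left ?_
      have h2 : Real.exp (N * ((1 - z.im) ^ 2 - z.re ^ 2)) ≤ 1 := by
        rw [Real.exp_le_one_iff]
        refine mul_nonpos_of_nonneg_of_nonpos hN ?_
        rw [hn] at hsq
        nlinarith
      calc _ ≤ 1 * ‖h z‖ := by gcongr
        _ ≤ M := by rw [one_mul]; exact hM z (hsub hz.1)
  · exact ⟨by simp; norm_num, by simp⟩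

/-- First `N` makes the gain `exp (N / 4)` beat `M / ε`; then `η = ε * exp (-N)` cancels the loss on
the diameter. Neither depends on `h`. -/
theorem exists_norm_lt_of_small_on_real (M : ℝ) {ε : ℝ} (hε : 0 < ε) :
    ∃ η > 0, ∀ h : ℂ → E, DifferentiableOn ℂ h (ball 0 2) → (∀ ζ ∈ ball (0 : ℂ) 2, ‖h ζ‖ ≤ M) →
      (∀ x : ℝ, |x| ≤ 1 → ‖h x‖ ≤ η) → ‖h (Complex.I / 2)‖ < ε := by
  set N : ℝ := 4 * (|M| / ε + 1) with hN
  have hN0 : 0 < N := by positivity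
  refine ⟨ε * Real.exp (-N), by positivity, fun h hd hM hη => ?_⟩
  have key := norm_mul_exp_le_max hN0.le hd hM hη
  rw [mul_assoc, ← Real.exp_add, neg_add_cancel, Real.exp_zero, mul_one] at key
  have h1 : |M| / ε + 1 < Real.exp (N / 4) := by
    have := Real.add_one_lt_exp (x := N / 4) (by positivity)
    have h2 : N / 4 = |M| / ε + 1 := by rw [hN]; ring
    linarith
  have h2 : |M| + ε < ε * Real.exp (N / 4) := by
    calc |M| + ε = ε * (|M| / ε + 1) := by field_simp
      _ < _ := by gcongr
  refine lt_of_mul_lt_mul_right (key.trans_lt ?_) (Real.exp_pos (N / 4)).le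
  refine max_lt ?_ ?_ <;> linarith [le_abs_self M, abs_nonneg M]

end TwoConstants

/-! ### Transfer to discs in the manifold through charts. -/

section Manifold

/-- Two holomorphic discs in `X` with values in `B(q, ρ)`, for some `q ∈ S`, which are `δ`-close on
the real diameter, are `ε`-close at `i / 2`. -/
def DiscsClose (E : Type*) [NormedAddCommGroup E] [NormedSpace ℂ E]
    {X : Type*} [MetricSpace X] [ChartedSpace E X] (S : Set X) (ρ ε δ : ℝ) : Prop :=
  ∀ q ∈ S, ∀ f g : ℂ → X, (∀ ζ ∈ ball (0 : ℂ) 2, MDifferentiableAt 𝓘(ℂ, ℂ) 𝓘(ℂ, E) f ζ) →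
    (∀ ζ ∈ ball (0 : ℂ) 2, MDifferentiableAt 𝓘(ℂ, ℂ) 𝓘(ℂ, E) g ζ) →
    MapsTo f (ball 0 2) (ball q ρ) → MapsTo g (ball 0 2) (ball q ρ) →
    (∀ x : ℝ, |x| ≤ 1 → dist (f x) (g x) < δ) →
    dist (f (Complex.I / 2)) (g (Complex.I / 2)) < ε

theorem DiscsClose.mono {E : Type*} [NormedAddCommGroup E] [NormedSpace ℂ E]
    {X : Type*} [MetricSpace X] [ChartedSpace E X] {S S' : Set X} {ρ ρ' ε δ δ' : ℝ}
    (h : DiscsClose E S ρ ε δ)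
    (hS : S' ⊆ S) (hρ : ρ' ≤ ρ) (hδ : δ' ≤ δ) : DiscsClose E S' ρ' ε δ' :=
  fun q hq f g hf hg hfm hgm hfg => h q (hS hq) f g hf hg
    (hfm.mono_right (ball_subset_ball hρ)) (hgm.mono_right (ball_subset_ball hρ))
    fun x hx => (hfg x hx).trans_le hδ

variable {E : Type*} [NormedAddCommGroup E] [NormedSpace ℂ E] [FiniteDimensional ℂ E]
  {X : Type*} [MetricSpace X] [ChartedSpace E X] [IsManifold 𝓘(ℂ, E) 1 X]

/-- On a compact neighbourhood inside the chart domain, the chart and its inverse are uniformly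
continuous, so the vector-valued estimate applies to the difference of the chart images. The radius
is fixed before `ε`. -/
theorem exists_discsClose_singleton (q : X) :
    ∃ ρ > 0, ∀ ε > 0, ∃ δ > 0, DiscsClose E ({q} : Set X) ρ ε δ := by
  have : ProperSpace E := FiniteDimensional.proper ℂ E
  have : LocallyCompactSpace X := ChartedSpace.locallyCompactSpace E X
  set φ := chartAt E q
  obtain ⟨Q, hQn, hQs, hQc⟩ := local_compact_nhds (chart_source_mem_nhds E q)
  obtain ⟨ρ, hρ, hρQ⟩ := Metric.mem_nhds_iff.1 hQn
  have hφc : ContinuousOn φ Q := φ.continuousOn.mono hQs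
  have hφQ : IsCompact (φ '' Q) := hQc.image_of_continuousOn hφc
  have hsymm : UniformContinuousOn φ.symm (φ '' Q) :=
    hφQ.uniformContinuousOn_of_continuous
      (φ.continuousOn_symm.mono (by
        rintro _ ⟨x, hx, rfl⟩
        exact φ.map_source (hQs hx)))
  have hφu : UniformContinuousOn φ Q := hQc.uniformContinuousOn_of_continuous hφc
  obtain ⟨M, hM⟩ := hφQ.isBounded.exists_norm_le
  refine ⟨ρ, hρ, fun ε hε => ?_⟩
  obtain ⟨ε', hε', hε''⟩ := Metric.uniformContinuousOn_iff.1 hsymm ε hε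
  obtain ⟨η, hη, hη'⟩ := exists_norm_lt_of_small_on_real (E := E) (M + M) hε'
  obtain ⟨δ, hδ, hδ'⟩ := Metric.uniformContinuousOn_iff.1 hφu η hη
  refine ⟨δ, hδ, ?_⟩
  rintro _ rfl f g hf hg hfm hgm hfg
  have hfQ : ∀ ζ ∈ ball (0 : ℂ) 2, f ζ ∈ Q := fun ζ hζ => hρQ (hfm hζ)
  have hgQ : ∀ ζ ∈ ball (0 : ℂ) 2, g ζ ∈ Q := fun ζ hζ => hρQ (hgm hζ)
  have hdiff : ∀ u : ℂ → X, (∀ ζ ∈ ball (0 : ℂ) 2, MDifferentiableAt 𝓘(ℂ, ℂ) 𝓘(ℂ, E) u ζ) →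
      (∀ ζ ∈ ball (0 : ℂ) 2, u ζ ∈ Q) → DifferentiableOn ℂ (φ ∘ u) (ball 0 2) := by
    intro u hu huQ ζ hζ
    have h1 : MDifferentiableAt 𝓘(ℂ, E) 𝓘(ℂ, E) φ (u ζ) :=
      mdifferentiableAt_atlas (chart_mem_atlas E _) (hQs (huQ ζ hζ))
    exact (h1.comp ζ (hu ζ hζ)).differentiableAt.differentiableWithinAt
  have hreal : ∀ x : ℝ, |x| ≤ 1 → (x : ℂ) ∈ ball (0 : ℂ) 2 := fun x hx => by
    simpa using hx.trans_lt (by norm_num)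
  have hI : Complex.I / 2 ∈ ball (0 : ℂ) 2 := by simp; norm_num
  have key := hη' (fun ζ => φ (f ζ) - φ (g ζ)) ((hdiff f hf hfQ).sub (hdiff g hg hgQ))
    (fun ζ hζ => (norm_sub_le _ _).trans (add_le_add (hM _ (mem_image_of_mem _ (hfQ ζ hζ)))
      (hM _ (mem_image_of_mem _ (hgQ ζ hζ)))))
    (fun x hx => by
      rw [← dist_eq_norm]
      exact (hδ' _ (hfQ _ (hreal x hx)) _ (hgQ _ (hreal x hx)) (hfg x hx)).le)
  rw [← dist_eq_norm] at key
  have := hε'' _ (mem_image_of_mem _ (hfQ _ hI)) _ (mem_image_of_mem _ (hgQ _ hI)) key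
  rwa [φ.left_inv (hQs (hfQ _ hI)), φ.left_inv (hQs (hgQ _ hI))] at this

theorem _root_.IsCompact.exists_discsClose {C : Set X} (hC : IsCompact C) :
    ∃ ρ > 0, ∀ ε > 0, ∃ δ > 0, DiscsClose E C ρ ε δ := by
  refine hC.induction_on (p := fun S => ∃ ρ > 0, ∀ ε > 0, ∃ δ > 0, DiscsClose E S ρ ε δ)
    ⟨1, one_pos, fun ε _ => ⟨1, one_pos, fun q hq => hq.elim⟩⟩ ?_ ?_ ?_
  · rintro S T hST ⟨ρ, hρ, h⟩
    refine ⟨ρ, hρ, fun ε hε => ?_⟩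
    obtain ⟨δ, hδ, h'⟩ := h ε hε
    exact ⟨δ, hδ, h'.mono hST le_rfl le_rfl⟩
  · rintro S T ⟨ρ₁, hρ₁, h₁⟩ ⟨ρ₂, hρ₂, h₂⟩
    refine ⟨min ρ₁ ρ₂, lt_min hρ₁ hρ₂, fun ε hε => ?_⟩
    obtain ⟨δ₁, hδ₁, h₁'⟩ := h₁ ε hε
    obtain ⟨δ₂, hδ₂, h₂'⟩ := h₂ ε hε
    refine ⟨min δ₁ δ₂, lt_min hδ₁ hδ₂, ?_⟩
    rintro q (hq | hq)
    · exact h₁'.mono Subset.rfl (min_le_left _ _) (min_le_left _ _) q hq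
    · exact h₂'.mono Subset.rfl (min_le_right _ _) (min_le_right _ _) q hq
  · intro q _
    obtain ⟨ρ, hρ, h⟩ := exists_discsClose_singleton (E := E) q
    -- Halving leaves room to move the centre: `ball q' (ρ / 2)` lies in `ball q ρ`.
    refine ⟨ball q (ρ / 2), mem_nhdsWithin_of_mem_nhds (ball_mem_nhds q (half_pos hρ)), ρ / 2,
      half_pos hρ, fun ε hε => ?_⟩
    obtain ⟨δ, hδ, h'⟩ := h ε hε
    refine ⟨δ, hδ, fun q' hq' f g hf hg hfm hgm hfg => ?_⟩
    have hsub : ball q' (ρ / 2) ⊆ ball q ρ :=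
      ball_subset_ball' (by linarith [mem_ball.1 hq'])
    exact h' q rfl f g hf hg (hfm.mono_right hsub) (hgm.mono_right hsub) hfg

end Manifold

/-! ### Tubes, real shifts and complex lines. -/

section Tube

variable {m : ℕ}

theorem mem_tube_iff {K : Set (Fin m → ℝ)} {z : Fin m → ℂ} :
    z ∈ tube K ↔ (fun j => (z j).im) ∈ K := by
  constructor
  · rintro ⟨x, y, hy, rfl⟩
    simpa [point] using hy
  · intro h
    refine ⟨fun j => (z j).re, _, h, funext fun j => ?_⟩
    simp [point, mul_comm Complex.I, Complex.re_add_im]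

theorem point_mem_tube {K : Set (Fin m → ℝ)} (x : Fin m → ℝ) {y : Fin m → ℝ} (hy : y ∈ K) :
    point x y ∈ tube K :=
  ⟨x, y, hy, rfl⟩

theorem tube_mono {K L : Set (Fin m → ℝ)} (h : K ⊆ L) : tube K ⊆ tube L := by
  rintro _ ⟨x, y, hy, rfl⟩
  exact point_mem_tube x (h hy)

theorem shift_point (t x y : Fin m → ℝ) : shift t (point x y) = point (x + t) y := by
  ext j
  simp [shift, point]
  ring

theorem isOpen_tube {Ω : Set (Fin m → ℝ)} (hΩ : IsOpen Ω) : IsOpen (tube Ω) := by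
  have : tube Ω = (fun (z : Fin m → ℂ) j => (z j).im) ⁻¹' Ω := ext fun z => mem_tube_iff
  rw [this]
  exact hΩ.preimage (by fun_prop)

/-- The complex line through `x + i y` with the real direction `v`. -/
def line (x y v : Fin m → ℝ) (ζ : ℂ) : Fin m → ℂ :=
  fun j => point x y j + ζ * (v j : ℂ)

theorem line_eq_point (x y v : Fin m → ℝ) (ζ : ℂ) :
    line x y v ζ = point (x + ζ.re • v) (y + ζ.im • v) := by
  ext j
  apply Complex.ext <;> simp [line, point]

theorem differentiable_line (x y v : Fin m → ℝ) : Differentiable ℂ (line x y v) := by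
  unfold line
  fun_prop

theorem dist_line_zero_le (x y v : Fin m → ℝ) (ζ : ℂ) :
    dist (line x y v ζ) (line x y v 0) ≤ ‖ζ‖ * ‖v‖ := by
  refine (dist_pi_le_iff (by positivity)).2 fun j => ?_
  rw [dist_eq_norm]
  simp only [line, zero_mul, add_zero, add_sub_cancel_left, norm_mul, Complex.norm_real]
  gcongr
  exact norm_le_pi_norm v j

end Tube

/-! ### Formal properties of the control relation. -/

section Shifts

variable {m : ℕ} {X : Type*} [MetricSpace X]

/-- Uniform closeness of two real shifts of `F` on `ℝ^m + i y` forces uniform closeness on the tube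
with base `S`. -/
def ControlsShifts (F : (Fin m → ℂ) → X) (y : Fin m → ℝ) (S : Set (Fin m → ℝ)) : Prop :=
  ∀ ε > 0, ∃ δ > 0, ∀ s t : Fin m → ℝ,
    (∀ x, dist (F (point (x + s) y)) (F (point (x + t) y)) < δ) →
    ∀ w ∈ S, ∀ x, dist (F (point (x + s) w)) (F (point (x + t) w)) < ε

variable {F : (Fin m → ℂ) → X}

theorem ControlsShifts.mono {y : Fin m → ℝ} {S T : Set (Fin m → ℝ)} (h : ControlsShifts F y T)
    (hST : S ⊆ T) : ControlsShifts F y S := fun ε hε =>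
  let ⟨δ, hδ, h'⟩ := h ε hε
  ⟨δ, hδ, fun s t hst w hw => h' s t hst w (hST hw)⟩

theorem ControlsShifts.trans {y w : Fin m → ℝ} {S : Set (Fin m → ℝ)}
    (h : ControlsShifts F y {w}) (h' : ControlsShifts F w S) : ControlsShifts F y S := by
  intro ε hε
  obtain ⟨δ, hδ, h₁⟩ := h' ε hε
  obtain ⟨η, hη, h₂⟩ := h δ hδ
  exact ⟨η, hη, fun s t hst => h₁ s t (h₂ s t hst w rfl)⟩

theorem ControlsShifts.union {y : Fin m → ℝ} {S T : Set (Fin m → ℝ)}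
    (hS : ControlsShifts F y S) (hT : ControlsShifts F y T) : ControlsShifts F y (S ∪ T) := by
  intro ε hε
  obtain ⟨δ₁, hδ₁, h₁⟩ := hS ε hε
  obtain ⟨δ₂, hδ₂, h₂⟩ := hT ε hε
  refine ⟨min δ₁ δ₂, lt_min hδ₁ hδ₂, fun s t hst w hw => ?_⟩
  rcases hw with hw | hw
  · exact h₁ s t (fun x => (hst x).trans_le (min_le_left _ _)) w hw
  · exact h₂ s t (fun x => (hst x).trans_le (min_le_right _ _)) w hw

end Shifts

/-! ### Propagation of closeness from one height to others. -/

section Holomorphic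

variable {m : ℕ} {E : Type*} [NormedAddCommGroup E] [NormedSpace ℂ E] [FiniteDimensional ℂ E]
  {X : Type*} [MetricSpace X] [ChartedSpace E X] [IsManifold 𝓘(ℂ, E) 1 X]
  {Ω : Set (Fin m → ℝ)} {F : (Fin m → ℂ) → X}

theorem exists_controlsShifts_ball (hΩo : IsOpen Ω)
    (hF : MDifferentiableOn 𝓘(ℂ, Fin m → ℂ) 𝓘(ℂ, E) F (tube Ω))
    (hFu : ∀ K : Set (Fin m → ℝ), IsCompact K → K ⊆ Ω → UniformContinuousOn F (tube K))
    (hFc : ∀ K : Set (Fin m → ℝ), IsCompact K → K ⊆ Ω → IsCompact (closure (F '' tube K)))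
    {y₀ : Fin m → ℝ} (hy₀ : y₀ ∈ Ω) :
    ∃ r > 0, ∀ y ∈ ball y₀ r, ControlsShifts F y (ball y₀ r) := by
  obtain ⟨R, hR, hRΩ⟩ := Metric.nhds_basis_closedBall.mem_iff.1 (hΩo.mem_nhds hy₀)
  set B := closedBall y₀ R
  have hB : IsCompact B := isCompact_closedBall y₀ R
  obtain ⟨ρ, hρ, hdisc⟩ := (hFc B hB hRΩ).exists_discsClose (E := E)
  obtain ⟨d, hd, hunif⟩ := Metric.uniformContinuousOn_iff.1 (hFu B hB hRΩ) (ρ / 2) (half_pos hρ)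
  -- Below `‖v‖ < 4 * r`, so a disc of radius `2` moves by less than `8 * r`; another `r` accounts
  -- for the distance from `y` to `y₀`.
  refine ⟨min R d / 9, by positivity, fun y hy ε hε => ?_⟩
  set r := min R d / 9 with hr
  have hrR : 9 * r ≤ R := by rw [hr]; linarith [min_le_left R d]
  have hrd : 9 * r ≤ d := by rw [hr]; linarith [min_le_right R d]
  have hr0 : 0 < r := by positivity
  obtain ⟨δ, hδ, hδ'⟩ := hdisc ε hε
  -- The bound `ρ / 2` on the distance of the disc centres puts the second disc in the `ρ`-ball
  -- about the first centre.
  refine ⟨min δ (ρ / 2), lt_min hδ (half_pos hρ), fun s t hst w hw x => ?_⟩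
  -- The factor `2` makes `ζ = i / 2` land exactly at height `w`.
  set v : Fin m → ℝ := (2 : ℝ) • (w - y) with hv
  have hvn : ‖v‖ < 4 * r := by
    rw [hv, norm_smul, ← dist_eq_norm]
    have := dist_triangle_right w y y₀
    rw [mem_ball] at hy hw
    norm_num
    linarith
  have hmem : ∀ a : Fin m → ℝ, ∀ ζ ∈ ball (0 : ℂ) 2, line a y v ζ ∈ tube B := by
    intro a ζ hζ
    rw [line_eq_point]
    refine point_mem_tube _ (mem_closedBall.2 ?_)
    have h1 : dist (y + ζ.im • v) y ≤ 2 * ‖v‖ := by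
      rw [dist_eq_norm, add_sub_cancel_left, norm_smul]
      gcongr
      exact (Complex.abs_im_le_norm ζ).trans (mem_ball_zero_iff.1 hζ).le
    have := dist_triangle (y + ζ.im • v) y y₀
    rw [mem_ball] at hy
    linarith
  have h0 : (0 : ℂ) ∈ ball (0 : ℂ) 2 := by simp
  have hnear : ∀ a : Fin m → ℝ, ∀ ζ ∈ ball (0 : ℂ) 2,
      dist (F (line a y v ζ)) (F (line a y v 0)) < ρ / 2 := by
    intro a ζ hζ
    refine hunif _ (hmem a ζ hζ) _ (hmem a 0 h0) ((dist_line_zero_le a y v ζ).trans_lt ?_)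
    have : ‖ζ‖ * ‖v‖ ≤ 2 * ‖v‖ := by
      gcongr
      exact (mem_ball_zero_iff.1 hζ).le
    linarith
  have hmd : ∀ a : Fin m → ℝ, ∀ ζ ∈ ball (0 : ℂ) 2,
      MDifferentiableAt 𝓘(ℂ, ℂ) 𝓘(ℂ, E) (fun ζ => F (line a y v ζ)) ζ := by
    intro a ζ hζ
    have h1 : MDifferentiableAt 𝓘(ℂ, Fin m → ℂ) 𝓘(ℂ, E) F (line a y v ζ) :=
      hF.mdifferentiableAt ((isOpen_tube hΩo).mem_nhds (tube_mono hRΩ (hmem a ζ hζ)))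
    exact h1.comp ζ (differentiable_line a y v ζ).mdifferentiableAt
  have hline : ∀ a : Fin m → ℝ, ∀ b : ℝ, line (x + a) y v b = point (x + b • v + a) y := by
    intro a b
    rw [line_eq_point]
    simp [add_right_comm]
  have hlineI : ∀ a : Fin m → ℝ, line a y v (Complex.I / 2) = point a w := by
    intro a
    rw [line_eq_point, hv]
    congr 1
    · simp
    · simp [smul_smul]
  have key := hδ' (F (line (x + s) y v 0))
    (subset_closure (mem_image_of_mem F (hmem (x + s) 0 h0)))
    (fun ζ => F (line (x + s) y v ζ)) (fun ζ => F (line (x + t) y v ζ)) (hmd _) (hmd _)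
    (fun ζ hζ => (hnear _ ζ hζ).trans (half_lt_self hρ))
    (fun ζ hζ => ?_) (fun b _ => ?_)
  · simpa only [hlineI] using key
  · have h1 := (hst (x + (0 : ℝ) • v)).trans_le (min_le_right _ _)
    rw [← hline, ← hline, Complex.ofReal_zero, dist_comm] at h1
    have h2 := dist_triangle (F (line (x + t) y v ζ)) (F (line (x + t) y v 0))
      (F (line (x + s) y v 0))
    have h3 := hnear (x + t) ζ hζ
    exact mem_ball.2 (by linarith)
  · simp only [hline]
    exact (hst _).trans_le (min_le_left _ _)

theorem controlsShifts_of_isCompact (hΩo : IsOpen Ω) (hΩc : IsPreconnected Ω)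
    (hF : MDifferentiableOn 𝓘(ℂ, Fin m → ℂ) 𝓘(ℂ, E) F (tube Ω))
    (hFu : ∀ K : Set (Fin m → ℝ), IsCompact K → K ⊆ Ω → UniformContinuousOn F (tube K))
    (hFc : ∀ K : Set (Fin m → ℝ), IsCompact K → K ⊆ Ω → IsCompact (closure (F '' tube K)))
    {y : Fin m → ℝ} (hy : y ∈ Ω) {K : Set (Fin m → ℝ)} (hK : IsCompact K) (hKΩ : K ⊆ Ω) :
    ControlsShifts F y K := by
  have hloc := fun w (hw : w ∈ Ω) => exists_controlsShifts_ball hΩo hF hFu hFc hw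
  have hconn : ∀ w ∈ Ω, ControlsShifts F y {w} := fun w hw =>
    -- Control between points is transitive and holds locally in both directions, so it links any
    -- two points of `Ω`.
    hΩc.induction₂' (fun a b => ControlsShifts F a {b})
      (fun a ha => by
        obtain ⟨r, hr, h⟩ := hloc a ha
        filter_upwards [mem_nhdsWithin_of_mem_nhds (ball_mem_nhds a hr)] with b hb
        exact ⟨(h a (mem_ball_self hr)).mono (singleton_subset_iff.2 hb),
          (h b hb).mono (singleton_subset_iff.2 (mem_ball_self hr))⟩)
      (fun a b c _ _ _ hab hbc => hab.trans hbc) hy hw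
  refine hK.induction_on (p := ControlsShifts F y)
    (fun ε _ => ⟨1, one_pos, fun _ _ _ w hw => hw.elim⟩) (fun S T hST hT => hT.mono hST)
    (fun S T hS hT => hS.union hT) fun w hw => ?_
  obtain ⟨r, hr, h⟩ := hloc w (hKΩ hw)
  exact ⟨ball w r, mem_nhdsWithin_of_mem_nhds (ball_mem_nhds w hr),
    (hconn w (hKΩ hw)).trans (h w (mem_ball_self hr))⟩

end Holomorphic

/-! ### Relative compactness and finite nets. -/

section UniformConvergence

theorem _root_.UniformFun.isCompact_closure_of_totallyBounded {α ι X : Type*} [MetricSpace X]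
    {C : Set X} (hC : IsCompact C) (u : ι → α → X) (hu : ∀ i a, u i a ∈ C)
    (htb : ∀ ε > 0, ∃ T : Set ι, T.Finite ∧ ∀ i, ∃ j ∈ T, ∀ a, dist (u i a) (u j a) < ε) :
    IsCompact (closure (range fun i => UniformFun.ofFun (u i))) := by
  have : CompleteSpace C := hC.isComplete.completeSpace_coe
  -- Passing to values in the complete space `C` makes the function space complete, with no
  -- completeness of `X`.
  set S : Set (UniformFun α C) :=
    range fun i => UniformFun.ofFun fun a => (⟨u i a, hu i a⟩ : C) with hS
  have hStb : TotallyBounded S := by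
    rw [(UniformFun.hasBasis_uniformity_of_basis α C
      Metric.uniformity_basis_dist).totallyBounded_iff]
    intro ε hε
    obtain ⟨T, hT, h⟩ := htb ε hε
    refine ⟨_, hT.image fun i => UniformFun.ofFun fun a => (⟨u i a, hu i a⟩ : C), ?_⟩
    rintro _ ⟨i, rfl⟩
    obtain ⟨j, hj, hij⟩ := h i
    exact mem_biUnion (mem_image_of_mem _ hj) fun a => hij a
  have hSc : IsCompact (closure S) :=
    hStb.closure.isCompact_of_isClosed isClosed_closure
  have hcont := (UniformFun.postcomp_uniformContinuous (α := α)
    (uniformContinuous_subtype_val (p := (· ∈ C)))).continuous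
  refine (hSc.image hcont).closure_of_subset ?_
  rintro _ ⟨i, rfl⟩
  exact ⟨_, subset_closure (mem_range_self i), rfl⟩

theorem _root_.UniformFun.exists_finite_of_isCompact_closure {α ι X : Type*} [MetricSpace X]
    {u : ι → α → X} (h : IsCompact (closure (range fun i => UniformFun.ofFun (u i))))
    {ε : ℝ} (hε : 0 < ε) :
    ∃ T : Set ι, T.Finite ∧ ∀ i, ∃ j ∈ T, ∀ a, dist (u i a) (u j a) < ε := by
  have htb := h.totallyBounded.subset subset_closure
  have hcover := htb.exists_subset
    ((UniformFun.hasBasis_uniformity_of_basis α X Metric.uniformity_basis_dist).mem_of_mem hε)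
  rw [← image_univ, exists_subset_image_finite_and] at hcover
  obtain ⟨T, -, hT, ht⟩ := hcover
  refine ⟨T, hT, fun i => ?_⟩
  obtain ⟨_, ⟨j, hj, rfl⟩, hij⟩ := mem_iUnion₂.1 (ht (mem_image_of_mem _ (mem_univ i)))
  exact ⟨j, hj, hij⟩

end UniformConvergence

end SemiPeriodic

theorem mainTheorem1 {m : ℕ}
    {E : Type*} [NormedAddCommGroup E] [NormedSpace ℂ E] [FiniteDimensional ℂ E]
    {X : Type*} [MetricSpace X] [ChartedSpace E X] [IsManifold 𝓘(ℂ, E) 1 X]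
    (Ω : Set (Fin m → ℝ)) (hΩo : IsOpen Ω) (hΩc : Convex ℝ Ω)
    (F : (Fin m → ℂ) → X)
    (hF : MDifferentiableOn 𝓘(ℂ, Fin m → ℂ) 𝓘(ℂ, E) F (SemiPeriodic.tube Ω))
    (hFu : ∀ K : Set (Fin m → ℝ), IsCompact K → K ⊆ Ω →
      UniformContinuousOn F (SemiPeriodic.tube K))
    (hFc : ∀ K : Set (Fin m → ℝ), IsCompact K → K ⊆ Ω →
      IsCompact (closure (F '' SemiPeriodic.tube K)))
    (y' : Fin m → ℝ) (hy' : y' ∈ Ω)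
    (hsp : SemiPeriodic.IsSemiPeriodicOnTube F {y'}) :
    SemiPeriodic.IsSemiPeriodicOnTubeDomain F Ω := by
  intro K hK hKΩ
  refine ⟨(hFu K hK hKΩ).continuousOn, ?_⟩
  refine UniformFun.isCompact_closure_of_totallyBounded (hFc K hK hKΩ) _ ?_ fun ε hε => ?_
  · rintro t ⟨_, x, y, hy, rfl⟩
    simp only [SemiPeriodic.shift_point]
    exact subset_closure (Set.mem_image_of_mem F (SemiPeriodic.point_mem_tube _ hy))
  · obtain ⟨δ, hδ, h⟩ := SemiPeriodic.controlsShifts_of_isCompact hΩo hΩc.isPreconnected hF hFu hFc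
      hy' hK hKΩ ε hε
    obtain ⟨T, hT, hcover⟩ := UniformFun.exists_finite_of_isCompact_closure hsp.2 hδ
    -- A finite `δ`-net of shifts at height `y'` is an `ε`-net on `T_K`.
    refine ⟨T, hT, fun s => ?_⟩
    obtain ⟨t, ht, hst⟩ := hcover s
    refine ⟨t, ht, ?_⟩
    rintro ⟨_, x, y, hy, rfl⟩
    simp only [SemiPeriodic.shift_point]
    refine h s t (fun x => ?_) y hy x
    have := hst ⟨_, SemiPeriodic.point_mem_tube x rfl⟩
    simpa only [SemiPeriodic.shift_point] using this
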